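/- There is an absolute constant $C$ (in particular independent of $D$, $d$ and $n$) such that the following holds. Let $P\subseteq\mathbb R^D$ be a polyhedron, defined as the intersection of a set of $n$ closed halfspaces; $P$ need not be full-dimensional. Let $\ell$ be an affine-linear function on $\mathbb R^D$ that attains a minimum on $P$, and let $B\in\mathbb R\cup\{\infty\}$. The faces of $P$ are $\emptyset$, $P$, and the intersections of $P$ with its supporting hyperplanes; the dimension of a face is the dimension of its affine hull, with $\dim\emptyset=-1$. For real $B$ let $P^{\ell<B}$ be the set of faces $F$ of $P$ such that $\ell(p)<B$ for every $p\in F$, and let $P^{\ell<\infty}$ be the set of faces of $P$ on which $\ell$ is bounded. Let $d=\dim P^{\ell<B}$ be the maximum dimension of a face in $P^{\ell<B}$, and suppose that $d<D$. Then $P^{\ell<B}$ has finitely many vertices ($0$-dimensional faces), and their number is at most $C\,n^d$ (where $0^{-1}$ is read as $0$ in the case $n=0$, $d=-1$, in which there are no vertices). -/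

import Mathlib

/-- `H` is a closed halfspace of `ℝ^D`. -/
def IsClosedHalfspace {D : ℕ} (H : Set (EuclideanSpace ℝ (Fin D))) : Prop :=
  ∃ (a : EuclideanSpace ℝ (Fin D)) (b : ℝ), a ≠ 0 ∧ H = {x | inner ℝ a x ≤ b}

/-- The polyhedron `⋂ T` defined by a finite set `T` of halfspaces. -/
def polyhedron {D : ℕ} (T : Finset (Set (EuclideanSpace ℝ (Fin D)))) :
    Set (EuclideanSpace ℝ (Fin D)) :=
  ⋂₀ (T : Set (Set (EuclideanSpace ℝ (Fin D))))

/-- The faces of a polyhedron `P`: the empty set, `P` itself, and the intersections of `P` with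
its supporting hyperplanes. (`IsExposed ℝ P F` says that `F` is empty or the set of all points
of `P` maximizing some linear functional; the zero functional gives `F = P`.) -/
def faces {D : ℕ} (P : Set (EuclideanSpace ℝ (Fin D))) :
    Set (Set (EuclideanSpace ℝ (Fin D))) :=
  {F | IsExposed ℝ P F}

open Classical in
/-- The dimension of a set: the dimension of its affine hull, and `-1` for the empty set. -/
noncomputable def polyDim {D : ℕ} (F : Set (EuclideanSpace ℝ (Fin D))) : ℤ :=
  if F.Nonempty then (Module.finrank ℝ (affineSpan ℝ F).direction : ℤ) else -1

/-- The condition on a face `F` to belong to `P^{ℓ<B}`: for real `B` it says `ℓ < B` everywhere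
on `F`, and for `B = ∞` it says that `ℓ` is bounded (above and below) on `F`. -/
def IsBelow {D : ℕ} (ℓ : EuclideanSpace ℝ (Fin D) →ᵃ[ℝ] ℝ) :
    WithTop ℝ → Set (EuclideanSpace ℝ (Fin D)) → Prop
  | some b, F => ∀ p ∈ F, ℓ p < b
  | none, F => BddAbove (ℓ '' F) ∧ BddBelow (ℓ '' F)

/-- The polyhedral complex `P^{ℓ<B}`, as a set of faces of `P`. -/
def belowComplex {D : ℕ} (P : Set (EuclideanSpace ℝ (Fin D)))
    (ℓ : EuclideanSpace ℝ (Fin D) →ᵃ[ℝ] ℝ) (B : WithTop ℝ) :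
    Set (Set (EuclideanSpace ℝ (Fin D))) :=
  {F | F ∈ faces P ∧ IsBelow ℓ B F}

/-- `d` is the dimension of the complex `K`, the maximum dimension of its members. -/
def IsComplexDim {D : ℕ} (K : Set (Set (EuclideanSpace ℝ (Fin D)))) (d : ℤ) : Prop :=
  IsGreatest (polyDim '' K) d

/-- The vertices of the complex `K`: its zero-dimensional members. -/
def complexVertices {D : ℕ} (K : Set (Set (EuclideanSpace ℝ (Fin D)))) :
    Set (Set (EuclideanSpace ℝ (Fin D))) :=
  {F | F ∈ K ∧ polyDim F = 0}

/-! Each vertex `v` is encoded by a set `J` of at most `d` constraints, so there are at most `∑ j ≤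
d, n.choose j ≤ e * n ^ d` vertices. Replace `ℓ` by a generic nearby cost `c'` and relax the
constraints by `ε * δ` with `δ > 0` generic, which makes the polyhedron simple. Among the basic
points of the relaxed system of constraints tight at `v`, choose `w` of least `c'`, with basis `S`.
A decreasing edge at `w` ending at another basic point would contradict minimality, so every
decreasing edge is an unbounded ray; `J ⊆ S` indexes these edges.

Size (`IsDecreasingSet.exists_face`): the rays are recession directions of the tight system at `v`,
so they are independent directions of the face where `S \ J` is tight. On it `ℓ ≤ ℓ v`, so it lies
in the complex and `J.card ≤ d`.

Injectivity (`IsDecreasingSet.injective`): if `v₁`, `v₂` share `J`, then `v₁ + ε • w₁` and `v₂ + ε •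
w₂` are both feasible for the relaxed system and tight on `J`. Each is the unique `c'`-minimizer
among such points, as its edges outside `J` increase. So they agree, and `ε → 0` gives `v₁ = v₂`. -/

open Filter Topology

/-! ### Generic right-hand sides and costs, edge directions -/

section LinearInequalities

variable {E : Type*} [NormedAddCommGroup E] [InnerProductSpace ℝ E] {ι : Type*}

/-- Finitely many proper subspaces do not cover a nonempty open set. -/
theorem exists_mem_open_forall_notMem_submodule {V : Type*} [NormedAddCommGroup V]
    [NormedSpace ℝ V] [FiniteDimensional ℝ V] {κ : Type*} {s : Set κ} (hs : s.Finite)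
    (p : κ → Submodule ℝ V) (hp : ∀ k ∈ s, p k ≠ ⊤) {O : Set V} (hO : IsOpen O)
    (hne : O.Nonempty) : ∃ x ∈ O, ∀ k ∈ s, x ∉ p k := by
  have : CompleteSpace V := FiniteDimensional.complete ℝ V
  have hd : Dense (⋂ k ∈ s, ((p k : Set V)ᶜ)) := by
    refine dense_biInter_of_isOpen (fun k _ => ?_) hs.countable (fun k hk => ?_)
    · exact (p k).closed_of_finiteDimensional.isOpen_compl
    · rw [← interior_eq_empty_iff_dense_compl]
      by_contra h
      exact hp k hk (Submodule.eq_top_of_nonempty_interior' _ (Set.nonempty_iff_ne_empty.2 h))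
  obtain ⟨x, hxO, hx⟩ := hd.inter_open_nonempty O hO hne
  exact ⟨x, hxO, fun k hk => by simpa using Set.mem_iInter₂.1 hx k hk⟩

/-- The vectors `a i`, `i ∈ S`, span the space. -/
def NormalsSpan (a : ι → E) (S : Finset ι) : Prop :=
  ∀ x : E, (∀ i ∈ S, inner ℝ (a i) x = 0) → x = 0

/-- `r` is the direction of the edge obtained by relaxing the constraint `i` among the
constraints in `S`. -/
def IsEdgeDir (a : ι → E) (S : Finset ι) (i : ι) (r : E) : Prop :=
  inner ℝ (a i) r = -1 ∧ ∀ k ∈ S, k ≠ i → inner ℝ (a k) r = 0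

/-- A right-hand side is generic if the constraints that are tight at a point have linearly
independent normals. -/
def IsGenericRhs (a : ι → E) (δ : ι → ℝ) : Prop :=
  ∀ (S : Finset ι) (u : E), (∀ i ∈ S, inner ℝ (a i) u = δ i) → ∀ i ∈ S, ∃ r, IsEdgeDir a S i r

/-- For each `S` the right-hand sides solvable on `S` form a subspace. If `δ` avoids all the proper
ones, solvability for `δ` implies solvability for every right-hand side, in particular for the one
defining an edge direction. -/
theorem exists_isGenericRhs_pos [Fintype ι] (a : ι → E) :
    ∃ δ : ι → ℝ, (∀ i, 0 < δ i) ∧ IsGenericRhs a δ := by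
  classical
  let p : Finset ι → Submodule ℝ (ι → ℝ) := fun S =>
    { carrier := {δ | ∃ u : E, ∀ i ∈ S, inner ℝ (a i) u = δ i}
      add_mem' := by
        rintro δ₁ δ₂ ⟨u₁, h₁⟩ ⟨u₂, h₂⟩
        exact ⟨u₁ + u₂, fun i hi => by rw [inner_add_right, h₁ i hi, h₂ i hi]; rfl⟩
      zero_mem' := ⟨0, fun i _ => by simp⟩
      smul_mem' := by
        rintro c δ ⟨u, h⟩
        exact ⟨c • u, fun i hi => by rw [inner_smul_right, h i hi]; rfl⟩ }
  have hO : IsOpen {δ : ι → ℝ | ∀ i, 0 < δ i} := by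
    simp only [Set.ofPred_forall]
    exact isOpen_iInter_of_finite fun i => isOpen_lt continuous_const (continuous_apply i)
  obtain ⟨δ, hδ, h⟩ := exists_mem_open_forall_notMem_submodule
    (Set.toFinite {S : Finset ι | p S ≠ ⊤}) p (fun _ h => h) hO ⟨fun _ => 1, fun _ => one_pos⟩
  refine ⟨δ, hδ, fun S u hu i hi => ?_⟩
  have hS : p S = ⊤ := by
    by_contra hne
    exact h S hne ⟨u, hu⟩
  obtain ⟨r, hr⟩ : (Pi.single i (-1) : ι → ℝ) ∈ p S := hS ▸ Submodule.mem_top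
  refine ⟨r, by simpa using hr i hi, fun k hk hki => ?_⟩
  rw [hr k hk, Pi.single_eq_of_ne hki]

/-- A cost is generic if it is constant on no edge direction. -/
def IsGenericCost (a : ι → E) (c : E) : Prop :=
  ∀ (S : Finset ι) (i : ι) (r : E), i ∈ S → NormalsSpan a S → IsEdgeDir a S i r →
    inner ℝ c r ≠ 0

/-- There are finitely many edge directions, so `c'` can avoid their orthogonal hyperplanes while
staying positive on every edge where `c` is positive. -/
theorem exists_isGenericCost [Finite ι] [FiniteDimensional ℝ E] (a : ι → E) (c : E) :
    ∃ c' : E, IsGenericCost a c' ∧ ∀ (S : Finset ι) (i : ι) (r : E), i ∈ S →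
      NormalsSpan a S → IsEdgeDir a S i r → inner ℝ c' r < 0 → inner ℝ c r ≤ 0 := by
  let U : Set E := ⋃ q : Finset ι × ι,
    {r | q.2 ∈ q.1 ∧ NormalsSpan a q.1 ∧ IsEdgeDir a q.1 q.2 r}
  have hU : U.Finite := by
    refine Set.finite_iUnion fun q => Set.Subsingleton.finite ?_
    rintro r ⟨_, hS, hr⟩ r' ⟨_, _, hr'⟩
    refine sub_eq_zero.1 (hS _ fun k hk => ?_)
    rw [inner_sub_right]
    by_cases hki : k = q.2
    · rw [hki, hr.1, hr'.1, sub_self]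
    · rw [hr.2 k hk hki, hr'.2 k hk hki, sub_self]
  have hO : IsOpen (⋂ r ∈ {r ∈ U | 0 < inner ℝ c r}, {x : E | 0 < inner ℝ x r}) :=
    (hU.subset (Set.sep_subset _ _)).isOpen_biInter fun r _ =>
      isOpen_lt continuous_const (by fun_prop)
  obtain ⟨c', hc', h⟩ := exists_mem_open_forall_notMem_submodule
    (hU.subset (Set.sep_subset U (· ≠ 0))) (fun r => (ℝ ∙ r)ᗮ) (by
      rintro r ⟨_, hr⟩ htop
      exact hr (inner_self_eq_zero.1
        ((Submodule.mem_orthogonal_singleton_iff_inner_right (𝕜 := ℝ)).1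
          (htop ▸ Submodule.mem_top : r ∈ (ℝ ∙ r)ᗮ)))) hO
    ⟨c, Set.mem_iInter₂.2 fun r hr => hr.2⟩
  refine ⟨c', fun S i r hi hS hr h0 => ?_, fun S i r hi hS hr hneg => ?_⟩
  · refine h r ⟨Set.mem_iUnion.2 ⟨(S, i), hi, hS, hr⟩, ?_⟩
      (Submodule.mem_orthogonal_singleton_iff_inner_left.2 h0)
    rintro rfl
    have := hr.1
    simp at this
  · by_contra hpos
    exact absurd (Set.mem_iInter₂.1 hc' r
      ⟨Set.mem_iUnion.2 ⟨(S, i), hi, hS, hr⟩, not_le.1 hpos⟩) hneg.le.not_gt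

/-- Expansion in the basis of edge directions. -/
theorem eq_sum_edgeDir {a : ι → E} {S : Finset ι} (hS : NormalsSpan a S) {r : ι → E}
    (hr : ∀ i ∈ S, IsEdgeDir a S i (r i)) (x : E) :
    x = ∑ i ∈ S, (-inner ℝ (a i) x) • r i := by
  refine sub_eq_zero.1 (hS _ fun k hk => ?_)
  rw [inner_sub_right, inner_sum, Finset.sum_eq_single k]
  · rw [inner_smul_right, (hr k hk).1]; ring
  · intro i hi hik
    rw [inner_smul_right, (hr i hi).2 k hk hik.symm, mul_zero]
  · exact fun h => absurd hk h

theorem inner_eq_sum_edgeDir {a : ι → E} {S : Finset ι} (hS : NormalsSpan a S) {r : ι → E}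
    (hr : ∀ i ∈ S, IsEdgeDir a S i (r i)) (c x : E) :
    inner ℝ c x = ∑ i ∈ S, (-inner ℝ (a i) x) * inner ℝ c (r i) := by
  conv_lhs => rw [eq_sum_edgeDir hS hr x]
  simp only [inner_sum, inner_smul_right]

/-! ### Basic feasible points and pivoting -/

/-- Following a ray out of a feasible point until a constraint becomes tight. -/
theorem exists_tight_on_ray (a : ι → E) (A : Finset ι) (δ : ι → ℝ) {u e : E}
    (hu : ∀ i ∈ A, inner ℝ (a i) u ≤ δ i) (he : ∃ k ∈ A, 0 < inner ℝ (a k) e) :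
    ∃ t : ℝ, 0 ≤ t ∧ (∀ i ∈ A, inner ℝ (a i) (u + t • e) ≤ δ i) ∧
      ∃ k ∈ A, 0 < inner ℝ (a k) e ∧ inner ℝ (a k) (u + t • e) = δ k := by
  classical
  obtain ⟨k, hk, hmin⟩ := (A.filter fun k => 0 < inner ℝ (a k) e).exists_min_image
    (fun k => (δ k - inner ℝ (a k) u) / inner ℝ (a k) e)
    (by obtain ⟨k, hk, h⟩ := he; exact ⟨k, Finset.mem_filter.2 ⟨hk, h⟩⟩)
  rw [Finset.mem_filter] at hk
  have ht : 0 ≤ (δ k - inner ℝ (a k) u) / inner ℝ (a k) e :=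
    div_nonneg (sub_nonneg.2 (hu k hk.1)) hk.2.le
  refine ⟨_, ht, fun i hi => ?_, k, hk.1, hk.2, ?_⟩
  · rw [inner_add_right, inner_smul_right]
    rcases le_or_gt (inner ℝ (a i) e) 0 with h | h
    · linarith [hu i hi, mul_nonpos_of_nonneg_of_nonpos ht h]
    · have := (le_div_iff₀ h).1 (hmin i (Finset.mem_filter.2 ⟨hi, h⟩))
      linarith
  · rw [inner_add_right, inner_smul_right, div_mul_cancel₀ _ hk.2.ne']; ring

/-- Start at `0`, feasible since `δ > 0`, and take a largest set of simultaneously tight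
constraints: if it did not span, a ray keeping it tight would hit one more. -/
theorem exists_basic_feasible (a : ι → E) (A : Finset ι) {δ : ι → ℝ} (hδ : ∀ i, 0 < δ i)
    (hA : NormalsSpan a A) :
    ∃ w : E, (∀ i ∈ A, inner ℝ (a i) w ≤ δ i) ∧
      ∃ S ⊆ A, NormalsSpan a S ∧ ∀ i ∈ S, inner ℝ (a i) w = δ i := by
  classical
  obtain ⟨S, hS, hmax⟩ := (A.powerset.filter fun S => ∃ w : E,
      (∀ i ∈ A, inner ℝ (a i) w ≤ δ i) ∧ ∀ i ∈ S, inner ℝ (a i) w = δ i).exists_max_image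
    Finset.card ⟨∅, by
      rw [Finset.mem_filter]
      exact ⟨Finset.empty_mem_powerset A, 0, fun i _ => by simpa using (hδ i).le, by simp⟩⟩
  simp only [Finset.mem_filter, Finset.mem_powerset] at hS hmax
  obtain ⟨hSA, w, hw, hwS⟩ := hS
  refine ⟨w, hw, S, hSA, ?_, hwS⟩
  by_contra hsep
  simp only [NormalsSpan, not_forall] at hsep
  obtain ⟨e, he, hne⟩ := hsep
  obtain ⟨e, he, hpos⟩ : ∃ e : E, (∀ i ∈ S, inner ℝ (a i) e = 0) ∧
      ∃ k ∈ A, 0 < inner ℝ (a k) e := by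
    by_contra! hcon
    refine hne (hA e fun k hk => le_antisymm (hcon e he k hk) ?_)
    have := hcon (-e) (fun i hi => by rw [inner_neg_right, he i hi, neg_zero]) k hk
    rw [inner_neg_right] at this
    linarith
  obtain ⟨t, _, hfeas, k, hk, hke, hkt⟩ := exists_tight_on_ray a A δ hw hpos
  have hkS : k ∉ S := fun h => hke.ne' (he k h)
  have := hmax (insert k S) ⟨Finset.insert_subset hk hSA, w + t • e, hfeas, fun i hi => by
    rcases Finset.mem_insert.1 hi with rfl | hi
    · exact hkt
    · rw [inner_add_right, inner_smul_right, he i hi, hwS i hi, mul_zero, add_zero]⟩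
  rw [Finset.card_insert_of_notMem hkS] at this
  omega

/-- The feasible basis with the least generic cost: the decreasing edges at it are unbounded. -/
theorem exists_basis_unbounded_decreasing (a : ι → E) (A : Finset ι) {δ : ι → ℝ} {c : E}
    (hδ : ∀ i, 0 < δ i) (hgen : IsGenericRhs a δ) (hA : NormalsSpan a A) :
    ∃ (w : E) (S : Finset ι) (r : ι → E), S ⊆ A ∧ NormalsSpan a S ∧
      (∀ i ∈ A, inner ℝ (a i) w ≤ δ i) ∧ (∀ i ∈ S, inner ℝ (a i) w = δ i) ∧
      (∀ i ∈ S, IsEdgeDir a S i (r i)) ∧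
      ∀ i ∈ S, inner ℝ c (r i) < 0 → ∀ k ∈ A, inner ℝ (a k) (r i) ≤ 0 := by
  classical
  let W : Set E := {w | (∀ i ∈ A, inner ℝ (a i) w ≤ δ i) ∧
      ∃ S ⊆ A, NormalsSpan a S ∧ ∀ i ∈ S, inner ℝ (a i) w = δ i}
  have hfin : W.Finite := by
    refine (A.powerset.finite_toSet.biUnion (t := fun S => {w | NormalsSpan a S ∧
      ∀ i ∈ S, inner ℝ (a i) w = δ i}) fun S _ => Set.Subsingleton.finite ?_).subset ?_
    · rintro w ⟨hS, hw⟩ w' ⟨_, hw'⟩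
      exact sub_eq_zero.1 (hS _ fun i hi => by rw [inner_sub_right, hw i hi, hw' i hi, sub_self])
    · rintro w ⟨_, S, hSA, h⟩
      exact Set.mem_biUnion (Finset.mem_coe.2 (Finset.mem_powerset.2 hSA)) h
  -- The minimum is over the finitely many basic points; on the whole feasible set `c` may be
  -- unbounded below.
  obtain ⟨w, ⟨hw, S, hSA, hS, hwS⟩, hmin⟩ :=
    W.exists_min_image (fun w => inner ℝ c w) hfin (exists_basic_feasible a A hδ hA)
  have hex := hgen S w hwS
  choose! r hr using hex
  refine ⟨w, S, r, hSA, hS, hw, hwS, hr, fun i hi hci => ?_⟩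
  by_contra! hpos
  obtain ⟨t, ht, hfeas, k, hk, hki, hkt⟩ := exists_tight_on_ray a A δ hw hpos
  have hkS : k ∉ S := by
    intro hkS
    by_cases h : k = i
    · rw [h, (hr i hi).1] at hki; norm_num at hki
    · exact hki.ne' ((hr i hi).2 k hkS h)
  -- A step of length zero would make `k` tight at `w` together with the spanning set `S`, against
  -- genericity.
  have ht0 : t ≠ 0 := by
    rintro rfl
    rw [zero_smul, add_zero] at hkt
    obtain ⟨q, hq, hqS⟩ := hgen (insert k S) w (fun j hj => by
      rcases Finset.mem_insert.1 hj with rfl | hj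
      exacts [hkt, hwS j hj]) k (Finset.mem_insert_self k S)
    have : q = 0 := hS q fun j hj =>
      hqS j (Finset.mem_insert_of_mem hj) fun h => hkS (h ▸ hj)
    rw [this, inner_zero_right] at hq
    norm_num at hq
  -- Pivot: `k` replaces `i` in the basis.
  have hmem : w + t • r i ∈ W := by
    refine ⟨hfeas, insert k (S.erase i),
      Finset.insert_subset hk ((S.erase_subset i).trans hSA), fun x hx => ?_, fun j hj => ?_⟩
    · have hxS := eq_sum_edgeDir hS hr x
      rw [Finset.sum_eq_single i] at hxS
      · have h0 := hx k (Finset.mem_insert_self _ _)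
        rw [hxS, inner_smul_right, mul_eq_zero] at h0
        rw [hxS, h0.resolve_right hki.ne', zero_smul]
      · intro j hj hji
        rw [hx j (Finset.mem_insert_of_mem (Finset.mem_erase.2 ⟨hji, hj⟩)), neg_zero, zero_smul]
      · exact fun h => absurd hi h
    · rcases Finset.mem_insert.1 hj with rfl | hj
      · exact hkt
      · rw [Finset.mem_erase] at hj
        rw [inner_add_right, inner_smul_right, (hr i hi).2 j hj.2 hj.1, hwS j hj.2, mul_zero,
          add_zero]
  have := hmin _ hmem
  simp only [inner_add_right, inner_smul_right] at this
  nlinarith [mul_neg_of_pos_of_neg (lt_of_le_of_ne ht ht0.symm) hci]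

/-! ### Encoding vertices by decreasing sets -/

/-- A slight move in a direction that is admissible for the tight constraints, with a
proportional relaxation of the constraints, preserves feasibility. -/
theorem eventually_feasible [Finite ι] {a : ι → E} {b δ : ι → ℝ} {v w : E}
    (hv : ∀ i, inner ℝ (a i) v ≤ b i)
    (hw : ∀ i, inner ℝ (a i) v = b i → inner ℝ (a i) w ≤ δ i) :
    ∀ᶠ ε : ℝ in 𝓝[>] 0, ∀ i, inner ℝ (a i) (v + ε • w) ≤ b i + ε * δ i := by
  rw [eventually_all]
  intro i
  rcases (hv i).eq_or_lt with h | h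
  · filter_upwards [self_mem_nhdsWithin] with ε hε
    rw [inner_add_right, inner_smul_right, h]
    have := mul_le_mul_of_nonneg_left (hw i h) (Set.mem_Ioi.1 hε).le
    linarith
  · refine eventually_nhdsWithin_of_eventually_nhds ?_
    have h1 : Continuous fun ε : ℝ => inner ℝ (a i) (v + ε • w) := by fun_prop
    have h2 : Continuous fun ε : ℝ => b i + ε * δ i := by fun_prop
    exact (h1.continuousAt.eventually_lt h2.continuousAt (by simpa using h)).mono
      fun _ h => h.le

/-- A feasible point whose edge directions outside `J` are all increasing is determined by `J`. -/
theorem eq_of_increasing_edges {a : ι → E} {β : ι → ℝ} {c : E} {J S : Finset ι} {r : ι → E}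
    (hS : NormalsSpan a S) (hr : ∀ i ∈ S, IsEdgeDir a S i (r i)) {x y : E}
    (hpos : ∀ i ∈ S, i ∉ J → 0 < inner ℝ c (r i))
    (hx : ∀ i ∈ S, inner ℝ (a i) x = β i) (hy : ∀ i ∈ S, inner ℝ (a i) y ≤ β i)
    (hyJ : ∀ i ∈ J, i ∈ S → inner ℝ (a i) y = β i) (hle : inner ℝ c y ≤ inner ℝ c x) :
    y = x := by
  have hdiff : ∀ i ∈ S, inner ℝ (a i) (y - x) ≤ 0 := fun i hi => by
    rw [inner_sub_right, hx i hi]; linarith [hy i hi]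
  have hJ : ∀ i ∈ S, i ∈ J → inner ℝ (a i) (y - x) = 0 := fun i hi hiJ => by
    rw [inner_sub_right, hx i hi, hyJ i hiJ hi, sub_self]
  -- Expanding `y - x` in edge directions makes its cost a sum of nonnegative terms; it is at most
  -- zero, so every term vanishes.
  have hterm : ∀ i ∈ S, 0 ≤ (-inner ℝ (a i) (y - x)) * inner ℝ c (r i) := fun i hi => by
    by_cases hiJ : i ∈ J
    · rw [hJ i hi hiJ, neg_zero, zero_mul]
    · exact mul_nonneg (neg_nonneg.2 (hdiff i hi)) (hpos i hi hiJ).le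
  have hsum : ∑ i ∈ S, (-inner ℝ (a i) (y - x)) * inner ℝ c (r i) = 0 := by
    refine le_antisymm ?_ (Finset.sum_nonneg hterm)
    rw [← inner_eq_sum_edgeDir hS hr, inner_sub_right]
    linarith
  refine sub_eq_zero.1 (hS _ fun i hi => ?_)
  by_cases hiJ : i ∈ J
  · exact hJ i hi hiJ
  · have := (Finset.sum_eq_zero_iff_of_nonneg hterm).1 hsum i hi
    exact neg_eq_zero.1 ((mul_eq_zero.1 this).resolve_right (hpos i hi hiJ).ne')

/-- `J` is the set of constraints that are left along the decreasing edges at a basis which is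
tight at the vertex `v` and feasible for a relaxation of the tight constraints. -/
def IsDecreasingSet (a : ι → E) (b δ : ι → ℝ) (c v : E) (J : Finset ι) : Prop :=
  ∃ (w : E) (S : Finset ι) (r : ι → E), (∀ i ∈ S, inner ℝ (a i) v = b i) ∧
    NormalsSpan a S ∧ (∀ i, inner ℝ (a i) v = b i → inner ℝ (a i) w ≤ δ i) ∧
    (∀ i ∈ S, inner ℝ (a i) w = δ i) ∧ (∀ i ∈ S, IsEdgeDir a S i (r i)) ∧ J ⊆ S ∧
    (∀ i ∈ S, i ∉ J → 0 < inner ℝ c (r i)) ∧ (∀ i ∈ J, inner ℝ c (r i) < 0) ∧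
    ∀ i ∈ J, ∀ k, inner ℝ (a k) v = b k → inner ℝ (a k) (r i) ≤ 0

theorem exists_isDecreasingSet [Fintype ι] {a : ι → E} {b δ : ι → ℝ} {c v : E}
    (hδ : ∀ i, 0 < δ i) (hgen : IsGenericRhs a δ) (hc : IsGenericCost a c)
    (hv : ∀ x : E, (∀ i, inner ℝ (a i) v = b i → inner ℝ (a i) x = 0) → x = 0) :
    ∃ J, IsDecreasingSet a b δ c v J := by
  classical
  obtain ⟨w, S, r, hSA, hS, hw, hwS, hr, hrec⟩ :=
    exists_basis_unbounded_decreasing a (Finset.univ.filter fun i => inner ℝ (a i) v = b i)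
      (c := c) hδ hgen (fun x hx => hv x fun i hi => hx i (by simpa using hi))
  simp only [Finset.mem_filter, Finset.mem_univ, true_and] at hw hrec
  refine ⟨S.filter fun i => inner ℝ c (r i) < 0, w, S, r,
    fun i hi => (Finset.mem_filter.1 (hSA hi)).2, hS, hw, hwS, hr, Finset.filter_subset _ _,
    fun i hi hiJ => ?_, fun i hi => (Finset.mem_filter.1 hi).2, fun i hi k hk => ?_⟩
  · rw [Finset.mem_filter, not_and, not_lt] at hiJ
    exact lt_of_le_of_ne (hiJ hi) (hc S i (r i) hi hS (hr i hi)).symm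
  · rw [Finset.mem_filter] at hi
    exact hrec i hi.1 hi.2 k hk

/-- Distinct vertices have distinct sets of decreasing constraints. -/
theorem IsDecreasingSet.injective [Finite ι] {a : ι → E} {b δ : ι → ℝ} {c v₁ v₂ : E}
    {J : Finset ι} (hv₁ : ∀ i, inner ℝ (a i) v₁ ≤ b i) (hv₂ : ∀ i, inner ℝ (a i) v₂ ≤ b i)
    (h₁ : IsDecreasingSet a b δ c v₁ J) (h₂ : IsDecreasingSet a b δ c v₂ J) : v₁ = v₂ := by
  obtain ⟨w₁, S₁, r₁, hb₁, hS₁, hw₁, ht₁, hr₁, hJ₁, hp₁, -, -⟩ := h₁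
  obtain ⟨w₂, S₂, r₂, hb₂, hS₂, hw₂, ht₂, hr₂, hJ₂, hp₂, -, -⟩ := h₂
  have heq : ∀ᶠ ε : ℝ in 𝓝[>] 0, v₁ + ε • w₁ = v₂ + ε • w₂ := by
    filter_upwards [eventually_feasible hv₁ hw₁, eventually_feasible hv₂ hw₂] with ε hf₁ hf₂
    have e₁ : ∀ i ∈ S₁, inner ℝ (a i) (v₁ + ε • w₁) = b i + ε * δ i := fun i hi => by
      rw [inner_add_right, inner_smul_right, hb₁ i hi, ht₁ i hi]
    have e₂ : ∀ i ∈ S₂, inner ℝ (a i) (v₂ + ε • w₂) = b i + ε * δ i := fun i hi => by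
      rw [inner_add_right, inner_smul_right, hb₂ i hi, ht₂ i hi]
    rcases le_total (inner ℝ c (v₁ + ε • w₁)) (inner ℝ c (v₂ + ε • w₂)) with h | h
    · exact eq_of_increasing_edges hS₂ hr₂ hp₂ e₂ (fun i _ => hf₁ i)
        (fun i hi _ => e₁ i (hJ₁ hi)) h
    · exact (eq_of_increasing_edges hS₁ hr₁ hp₁ e₁ (fun i _ => hf₂ i)
        (fun i hi _ => e₂ i (hJ₂ hi)) h).symm
  have lim : ∀ v w : E, Tendsto (fun ε : ℝ => v + ε • w) (𝓝[>] 0) (𝓝 v) := fun v w => by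
    have : Continuous fun ε : ℝ => v + ε • w := by fun_prop
    exact (by simpa using this.tendsto 0 : Tendsto (fun ε : ℝ => v + ε • w) (𝓝 0) (𝓝 v)).mono_left
      nhdsWithin_le_nhds
  exact tendsto_nhds_unique_of_eventuallyEq (lim v₁ w₁) (lim v₂ w₂) heq

end LinearInequalities

/-! ### Faces spanned by decreasing edges -/

section Vertices

variable {E : Type*} [NormedAddCommGroup E] [InnerProductSpace ℝ E] {ι : Type*}

theorem linearIndepOn_edgeDir {a : ι → E} {S : Finset ι} {r : ι → E}
    (hr : ∀ i ∈ S, IsEdgeDir a S i (r i)) : LinearIndependent ℝ fun i : S => r i := by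
  rw [linearIndependent_iff']
  intro s g hg i hi
  have h := congrArg (inner ℝ (a i)) hg
  rw [inner_sum, inner_zero_right, Finset.sum_eq_single i, inner_smul_right,
    (hr i i.2).1] at h
  · linarith
  · intro j _ hji
    rw [inner_smul_right, (hr j j.2).2 i i.2 fun h => hji (Subtype.ext h.symm), mul_zero]
  · exact fun h => absurd hi h

/-- The decreasing edges span the recession cone of a face on which the cost is at most its
value at the vertex. -/
theorem IsDecreasingSet.exists_face [Finite ι] [FiniteDimensional ℝ E] {a : ι → E}
    {b δ : ι → ℝ} {c c' v : E} {J : Finset ι} (hv : ∀ i, inner ℝ (a i) v ≤ b i)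
    (hJ : IsDecreasingSet a b δ c' v J)
    (hc : ∀ (S : Finset ι) (i : ι) (r : E), i ∈ S → NormalsSpan a S → IsEdgeDir a S i r →
      inner ℝ c' r < 0 → inner ℝ c r ≤ 0) :
    ∃ F : Set E, IsExposed ℝ {x | ∀ i, inner ℝ (a i) x ≤ b i} F ∧ v ∈ F ∧
      (∀ x ∈ F, inner ℝ c x ≤ inner ℝ c v) ∧
      J.card ≤ Module.finrank ℝ (affineSpan ℝ F).direction := by
  classical
  obtain ⟨w, S, r, hb, hS, -, -, hr, hJS, -, hneg, hrec⟩ := hJ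
  let F : Set E := {x | (∀ i, inner ℝ (a i) x ≤ b i) ∧ ∀ i ∈ S \ J, inner ℝ (a i) x = b i}
  have hvF : v ∈ F := ⟨hv, fun i hi => hb i (Finset.mem_sdiff.1 hi).1⟩
  have hedge : ∀ i ∈ J, r i ∈ (affineSpan ℝ F).direction := by
    intro i hi
    obtain ⟨ε, hε, hpos⟩ := ((eventually_feasible (δ := 0) hv (hrec i hi)).and
      (self_mem_nhdsWithin : Set.Ioi (0 : ℝ) ∈ 𝓝[>] 0)).exists
    have hmem : v + ε • r i ∈ F := by
      refine ⟨fun k => by simpa using hε k, fun k hk => ?_⟩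
      rw [Finset.mem_sdiff] at hk
      rw [inner_add_right, inner_smul_right, hb k hk.1,
        (hr i (hJS hi)).2 k hk.1 fun h => hk.2 (h ▸ hi), mul_zero, add_zero]
    have := AffineSubspace.vsub_mem_direction (subset_affineSpan ℝ F hmem)
      (subset_affineSpan ℝ F hvF)
    rw [vsub_eq_sub, add_sub_cancel_left] at this
    exact (Submodule.smul_mem_iff _ (Set.mem_Ioi.1 hpos).ne').1 this
  -- The sum of the normals is maximal exactly where all the constraints in `S \ J` are tight.
  refine ⟨F, fun _ => ⟨innerSL ℝ (∑ i ∈ S \ J, a i), ?_⟩, hvF, fun x hx => ?_, ?_⟩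
  · have hle : ∀ y ∈ {x : E | ∀ i, inner ℝ (a i) x ≤ b i},
        inner ℝ (∑ i ∈ S \ J, a i) y ≤ ∑ i ∈ S \ J, b i := fun y hy => by
      rw [sum_inner]
      exact Finset.sum_le_sum fun i _ => hy i
    have heq : ∀ y ∈ F, inner ℝ (∑ i ∈ S \ J, a i) y = ∑ i ∈ S \ J, b i := fun y hy => by
      rw [sum_inner]
      exact Finset.sum_congr rfl hy.2
    ext x
    refine ⟨fun hx => ⟨hx.1, fun y hy => ?_⟩, fun hx => ⟨hx.1, ?_⟩⟩
    · rw [innerSL_apply_apply, innerSL_apply_apply, heq x hx]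
      exact hle y hy
    · have h := hx.2 v hv
      rw [innerSL_apply_apply, innerSL_apply_apply, heq v hvF, sum_inner] at h
      exact (Finset.sum_eq_sum_iff_of_le fun i _ => hx.1 i).1
        (le_antisymm (Finset.sum_le_sum fun i _ => hx.1 i) h)
  · rw [← sub_nonpos, ← inner_sub_right, inner_eq_sum_edgeDir hS hr c (x - v)]
    refine Finset.sum_nonpos fun i hi => ?_
    rw [inner_sub_right, hb i hi]
    by_cases hiJ : i ∈ J
    · exact mul_nonpos_of_nonneg_of_nonpos (by linarith [hx.1 i])
        (hc S i (r i) hi hS (hr i hi) (hneg i hiJ))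
    · rw [hx.2 i (Finset.mem_sdiff.2 ⟨hi, hiJ⟩), sub_self, neg_zero, zero_mul]
  · have hli : LinearIndependent ℝ
        (fun i : J => (⟨r i, hedge i i.2⟩ : (affineSpan ℝ F).direction)) := by
      refine LinearIndependent.of_comp (affineSpan ℝ F).direction.subtype ?_
      exact (linearIndepOn_edgeDir hr).comp (fun i : J => (⟨i, hJS i.2⟩ : S))
        fun i j h => Subtype.ext (congrArg (fun k : S => (k : ι)) h)
    simpa using hli.fintype_card_le_finrank

/-- The normals of the constraints that are tight at a vertex span the space. -/
theorem normalsSpan_of_isExposed_singleton [Finite ι] {a : ι → E} {b : ι → ℝ} {v : E}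
    (hv : IsExposed ℝ {x | ∀ i, inner ℝ (a i) x ≤ b i} {v}) (x : E)
    (hx : ∀ i, inner ℝ (a i) v = b i → inner ℝ (a i) x = 0) : x = 0 := by
  obtain ⟨l, hl⟩ := hv ⟨v, rfl⟩
  have hvl : v ∈ {x : E | (∀ i, inner ℝ (a i) x ≤ b i) ∧
      ∀ y, (∀ i, inner ℝ (a i) y ≤ b i) → l y ≤ l x} := (Set.ext_iff.1 hl v).1 rfl
  obtain ⟨hvP, hmax⟩ := hvl
  -- Both `v + ε • x` and `v - ε • x` are feasible, so the functional exposing `v` is also maximal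
  -- at `v + ε • x`.
  obtain ⟨ε, ⟨h₁, h₂⟩, hpos⟩ := (((eventually_feasible (δ := 0) (w := x) hvP
    (fun i hi => (hx i hi).le)).and (eventually_feasible (δ := 0) (w := -x) hvP
    (fun i hi => by rw [inner_neg_right, hx i hi, neg_zero]; rfl))).and
      (self_mem_nhdsWithin : Set.Ioi (0 : ℝ) ∈ 𝓝[>] 0)).exists
  simp only [Pi.zero_apply, mul_zero, add_zero] at h₁ h₂
  have hle₂ := hmax _ h₂
  have hmem : v + ε • x ∈ ({v} : Set E) := by
    rw [hl]
    refine ⟨h₁, fun y hy => (hmax y hy).trans ?_⟩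
    simp only [map_add, map_smul, map_neg, smul_neg] at hle₂ ⊢
    linarith
  have h0 : ε • x = 0 := by simpa using hmem
  exact (smul_eq_zero.1 h0).resolve_left (Set.mem_Ioi.1 hpos).ne'

end Vertices

/-! ### Application to the complex and counting -/

theorem polyDim_eq_zero_iff {D : ℕ} {F : Set (EuclideanSpace ℝ (Fin D))} :
    polyDim F = 0 ↔ ∃ v, F = {v} := by
  constructor
  · intro h
    unfold polyDim at h
    split_ifs at h with hne
    obtain ⟨v, hv⟩ := hne
    refine ⟨v, Set.eq_singleton_iff_unique_mem.2 ⟨hv, fun x hx => ?_⟩⟩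
    have hbot := Submodule.finrank_eq_zero.1 (Nat.cast_eq_zero.1 h)
    have := AffineSubspace.vsub_mem_direction (subset_affineSpan ℝ F hx)
      (subset_affineSpan ℝ F hv)
    rw [hbot, Submodule.mem_bot, vsub_eq_sub] at this
    exact sub_eq_zero.1 this
  · rintro ⟨v, rfl⟩
    simp [polyDim, direction_affineSpan]

/-- For `B = ∞` the face must also be bounded below, which is where the minimum of `ℓ` on the
polyhedron enters. -/
theorem IsBelow.mono_of_le {D : ℕ} {ℓ : EuclideanSpace ℝ (Fin D) →ᵃ[ℝ] ℝ} {B : WithTop ℝ}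
    {v x₀ : EuclideanSpace ℝ (Fin D)} {F : Set (EuclideanSpace ℝ (Fin D))}
    (hv : IsBelow ℓ B {v}) (hup : ∀ x ∈ F, ℓ x ≤ ℓ v) (hlow : ∀ x ∈ F, ℓ x₀ ≤ ℓ x) :
    IsBelow ℓ B F := by
  cases B with
  | top =>
    exact ⟨⟨ℓ v, Set.forall_mem_image.2 hup⟩, ⟨ℓ x₀, Set.forall_mem_image.2 hlow⟩⟩
  | coe b => exact fun p hp => (hup p hp).trans_lt (hv v rfl)

theorem exists_inner_eq_affineMap {D : ℕ} (ℓ : EuclideanSpace ℝ (Fin D) →ᵃ[ℝ] ℝ) :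
    ∃ c, ∀ x y, ℓ x - ℓ y = inner ℝ c x - inner ℝ c y := by
  refine ⟨(InnerProductSpace.toDual ℝ _).symm ℓ.linear.toContinuousLinearMap, fun x y => ?_⟩
  rw [← inner_sub_right, InnerProductSpace.toDual_symm_apply]
  exact (ℓ.linearMap_vsub x y).symm

/-- A system of inequalities defining a polyhedron, one for each halfspace. -/
theorem exists_inequalities {D : ℕ} {T : Finset (Set (EuclideanSpace ℝ (Fin D)))}
    (hT : ∀ H ∈ T, IsClosedHalfspace H) :
    ∃ (a : T → EuclideanSpace ℝ (Fin D)) (b : T → ℝ),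
      polyhedron T = {x | ∀ i, inner ℝ (a i) x ≤ b i} := by
  choose a b _ hab using fun i : T => hT i i.2
  refine ⟨a, b, Set.ext fun x => ?_⟩
  simp only [polyhedron, Set.mem_sInter, Finset.mem_coe, Set.mem_ofPred_eq]
  refine ⟨fun h i => ?_, fun h H hH => ?_⟩
  · have := h i i.2
    rwa [hab i] at this
  · rw [show H = _ from hab ⟨H, hH⟩]
    exact h ⟨H, hH⟩

/-- The map from vertices to decreasing sets bounds the number of vertices. -/
theorem exists_injOn_complexVertices {D d : ℕ} {T : Finset (Set (EuclideanSpace ℝ (Fin D)))}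
    {ℓ : EuclideanSpace ℝ (Fin D) →ᵃ[ℝ] ℝ} {B : WithTop ℝ}
    (hT : ∀ H ∈ T, IsClosedHalfspace H)
    (hmin : ∃ x ∈ polyhedron T, IsMinOn ℓ (polyhedron T) x)
    (hd : ∀ F ∈ belowComplex (polyhedron T) ℓ B, polyDim F ≤ d) :
    ∃ f : Set (EuclideanSpace ℝ (Fin D)) → Finset T,
      Set.MapsTo f (complexVertices (belowComplex (polyhedron T) ℓ B)) {J | J.card ≤ d} ∧
      Set.InjOn f (complexVertices (belowComplex (polyhedron T) ℓ B)) := by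
  obtain ⟨a, b, hP⟩ := exists_inequalities hT
  obtain ⟨c, hcℓ⟩ := exists_inner_eq_affineMap ℓ
  obtain ⟨δ, hδ, hgen⟩ := exists_isGenericRhs_pos a
  obtain ⟨c', hc', hcc'⟩ := exists_isGenericCost a c
  obtain ⟨x₀, -, hx₀⟩ := hmin
  rw [isMinOn_iff] at hx₀
  have key : ∀ F ∈ complexVertices (belowComplex (polyhedron T) ℓ B),
      ∃ J : Finset T, J.card ≤ d ∧ ∃ v, F = {v} ∧ (∀ i, inner ℝ (a i) v ≤ b i) ∧
        IsDecreasingSet a b δ c' v J := by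
    rintro F ⟨⟨hF, hB⟩, h0⟩
    obtain ⟨v, rfl⟩ := polyDim_eq_zero_iff.1 h0
    have hvexp : IsExposed ℝ {x | ∀ i, inner ℝ (a i) x ≤ b i} {v} := hP ▸ hF
    have hv : ∀ i, inner ℝ (a i) v ≤ b i := hvexp.subset rfl
    obtain ⟨J, hJ⟩ :=
      exists_isDecreasingSet hδ hgen hc' (normalsSpan_of_isExposed_singleton hvexp)
    refine ⟨J, ?_, v, rfl, hv, hJ⟩
    obtain ⟨G, hG, hvG, hle, hcard⟩ := hJ.exists_face hv hcc'
    rw [← hP] at hG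
    have hdim := hd G ⟨hG, hB.mono_of_le (fun x hx => by linarith [hcℓ x v, hle x hx])
      fun x hx => hx₀ x (hG.subset hx)⟩
    rw [polyDim, if_pos ⟨v, hvG⟩] at hdim
    exact hcard.trans (Nat.cast_le.1 hdim)
  choose! f hf using key
  refine ⟨f, fun F hF => (hf F hF).1, fun F hF G hG h => ?_⟩
  obtain ⟨-, v, hFv, hv, hJ⟩ := hf F hF
  obtain ⟨-, u, hGu, hu, hJ'⟩ := hf G hG
  rw [hFv, hGu, IsDecreasingSet.injective hv hu (h ▸ hJ) hJ']

theorem card_filter_card_le {κ : Type*} [Fintype κ] (d : ℕ) :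
    (Finset.univ.filter fun J : Finset κ => J.card ≤ d).card =
      ∑ j ∈ Finset.range (d + 1), (Fintype.card κ).choose j := by
  classical
  rw [Finset.card_eq_sum_card_fiberwise (f := Finset.card) (t := Finset.range (d + 1))]
  · refine Finset.sum_congr rfl fun j hj => ?_
    rw [← Finset.card_univ, ← Finset.card_powersetCard]
    congr 1
    ext J
    have := Finset.mem_range.1 hj
    simp only [Finset.mem_filter, Finset.mem_univ, true_and, Finset.mem_powersetCard,
      Finset.subset_univ]
    omega
  · intro J hJ
    simpa [Nat.lt_succ_iff] using hJ

/-- Use `n.choose j ≤ n ^ j / j! ≤ n ^ d / j!` and sum `1 / j!` to at most `e`. -/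
theorem sum_choose_le_exp_mul_pow {n : ℕ} (d : ℕ) (hn : n ≠ 0) :
    ((∑ j ∈ Finset.range (d + 1), n.choose j : ℕ) : ℝ) ≤ Real.exp 1 * (n : ℝ) ^ d := by
  have h1 : (1 : ℝ) ≤ n := by exact_mod_cast Nat.one_le_iff_ne_zero.2 hn
  refine le_trans ?_ (mul_le_mul_of_nonneg_right
    (Real.sum_le_exp_of_nonneg zero_le_one (d + 1)) (by positivity))
  rw [Finset.sum_mul, Nat.cast_sum]
  refine Finset.sum_le_sum fun j hj => (Nat.choose_le_pow_div j n).trans ?_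
  rw [one_pow, div_mul_eq_mul_div, one_mul]
  gcongr
  exact Nat.lt_succ_iff.1 (Finset.mem_range.1 hj)

/-- Without constraints there are no vertices in positive dimension. -/
theorem card_ne_zero_of_vertex {D : ℕ} {T : Finset (Set (EuclideanSpace ℝ (Fin D)))}
    (hT : ∀ H ∈ T, IsClosedHalfspace H) {v : EuclideanSpace ℝ (Fin D)} (hD : 0 < D)
    (hv : IsExposed ℝ (polyhedron T) {v}) : T.card ≠ 0 := by
  intro h
  obtain ⟨a, b, hP⟩ := exists_inequalities hT
  rw [Finset.card_eq_zero] at h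
  subst h
  rw [hP] at hv
  have hall := normalsSpan_of_isExposed_singleton hv
  have : EuclideanSpace.single (⟨0, hD⟩ : Fin D) (1 : ℝ) = 0 :=
    hall _ fun i => absurd i.2 (Finset.notMem_empty _)
  simp at this

theorem mainTheorem6 :
    ∃ C : ℝ, ∀ (D n : ℕ) (T : Finset (Set (EuclideanSpace ℝ (Fin D))))
      (ℓ : EuclideanSpace ℝ (Fin D) →ᵃ[ℝ] ℝ) (B : WithTop ℝ) (d : ℤ),
      T.card = n →
      (∀ H ∈ T, IsClosedHalfspace H) →
      (∃ x ∈ polyhedron T, IsMinOn ℓ (polyhedron T) x) →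
      IsComplexDim (belowComplex (polyhedron T) ℓ B) d →
      d < (D : ℤ) →
      (complexVertices (belowComplex (polyhedron T) ℓ B)).Finite ∧
        ((complexVertices (belowComplex (polyhedron T) ℓ B)).ncard : ℝ) ≤ C * (n : ℝ) ^ d := by
  refine ⟨Real.exp 1, ?_⟩
  rintro D n T ℓ B d rfl hT hmin hd hdD
  have hub : ∀ F ∈ belowComplex (polyhedron T) ℓ B, polyDim F ≤ d := fun F hF =>
    hd.2 (Set.mem_image_of_mem _ hF)
  rcases (complexVertices (belowComplex (polyhedron T) ℓ B)).eq_empty_or_nonempty with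
    hV | ⟨F, hF⟩
  · rw [hV]
    refine ⟨Set.finite_empty, ?_⟩
    rw [Set.ncard_empty, Nat.cast_zero]
    positivity
  · have hd0 : 0 ≤ d := hF.2 ▸ hub F hF.1
    lift d to ℕ using hd0
    obtain ⟨f, hmaps, hinj⟩ := exists_injOn_complexVertices hT hmin hub
    refine ⟨Set.Finite.of_injOn hmaps hinj (Set.toFinite _), ?_⟩
    obtain ⟨v, rfl⟩ := polyDim_eq_zero_iff.1 hF.2
    -- The case `n = 0` must be excluded because `n ^ j ≤ n ^ d` fails there for `j = 0 < d`; `0 ≤ d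
    -- < D` gives `0 < D`.
    have hT0 : T.card ≠ 0 := card_ne_zero_of_vertex hT (by omega) hF.1.1
    have hcard := Set.ncard_le_ncard_of_injOn f hmaps hinj (Set.toFinite _)
    rw [show {J : Finset T | J.card ≤ d} =
        ((Finset.univ.filter fun J : Finset T => J.card ≤ d : Finset (Finset T)) :
          Set (Finset T)) by ext; simp,
      Set.ncard_coe_finset, card_filter_card_le, Fintype.card_coe] at hcard
    rw [zpow_natCast]
    exact (Nat.cast_le.2 hcard).trans (sum_choose_le_exp_mul_pow d hT0)
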